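/- Setup. For a price vector $q\in\mathbf R_+^K$ let $\mathcal B(q)=\{y\in\mathbf R_+^K: q'y=1\}$. Let $p_0,p_1,\dots,p_J\in\mathbf R_+^K$ with $p_0\neq 0$, and $\mathcal B_j=\mathcal B(p_j)$. A bundle $d$ is a demand of the utility function $u$ at $q$ if $d\in\mathcal B(q)$ and $u(d)\ge u(y)$ for all $y\in\mathbf R_+^K$ with $q'y\le 1$. Distributions $(P_j)_j$ on the budgets $(\mathcal B_j)_j$ are rationalizable if there are, on some probability space, a random locally nonsatiated utility function $u:\mathbf R_+^K\to\mathbf R$ and random vectors $y(p_j)$ with law $P_j$ such that almost surely, for every $j$, $y(p_j)$ is a demand of $u$ at $p_j$ (ties may be broken in any way). A nonstochastic system $(d_j)_j$ is rationalizable if there is one locally nonsatiated $u$ such that each $d_j$ is a demand of $u$ at $p_j$. The patches are the classes of the partition of $\bigcup_{j=0}^J\mathcal B_j$ in which $y,\tilde y$ are equivalent iff $\operatorname{sg}(p_j'y-1)=\operatorname{sg}(p_j'\tilde y-1)$ for $j=0,\dots,J$; let $x^*_{1|j},\dots,x^*_{I^*_j|j}$ be the patches contained in $\mathcal B_j$.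 The vector representation of a nonstochastic system $(d_0,\dots,d_J)$, $d_j\in\mathcal B_j$, is the binary vector with entries $\mathbf 1\{d_j\in x^*_{i|j}\}$ ($0\le j\le J$, $1\le i\le I_j^*$). Let $A^*$ be the matrix whose $H^*$ columns are the distinct vector representations of the rationalizable nonstochastic systems on $(\mathcal B_0,\dots,\mathcal B_J)$; let $A_0^*$ be its rows with $j=0$ and $A_1^*$ its rows with $j\ge 1$. Let $(P_1,\dots,P_J)$ be rationalizable, let $\pi_1^*$ be the vector of the observed probabilities $P_j(x^*_{i|j})$ ($1\le j\le J$), and let $\mathcal N=\{\nu\in\Delta^{H^*-1}: A_1^*\nu=\pi_1^*\}$, where $\Delta^{H^*-1}$ is the unit simplex. The possible laws of counterfactual demand $y(p_0)$ are the distributions $P_0$ such that $(P_0,P_1,\dots,P_J)$ is rationalizable. Bounds on a functional of the law of $y(p_0)$ are called sharp if they are the infimum and the supremum of its values over all possible laws. Claim. (a) For every (Borel) event $x\subseteq\mathcal B_0$, the minimum and the maximum below exist and the bounds $$\min_{\nu\in\mathcal N}\ \sum_{i:\,x^*_{i|0}\subseteq x} e_i'A_0^*\nu\ \le\ \Pr(y(p_0)\in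 x)\ \le\ \max_{\nu\in\mathcal N}\ \sum_{i:\,x^*_{i|0}\cap x\neq\emptyset} e_i'A_0^*\nu$$ are sharp, where $e_i$ is the $i$-th canonical basis vector of $\mathbf R^{I_0^*}$. (b) For every $z\in\mathbf R^K$ and $t\in\mathbf R$ put $\underline m_i=\inf\{z'y:y\in x^*_{i|0}\}$, $\overline m_i=\sup\{z'y:y\in x^*_{i|0}\}$ (in $[-\infty,\infty]$), $\underline p_i=\mathbf 1\{\overline m_i\le t\}$ and $\overline p_i=\mathbf 1\{x^*_{i|0}\cap\{y:z'y\le t\}\neq\emptyset\}$ for $1\le i\le I^*_0$. Then $\underline m_i<t$ implies $\overline p_i=1$ and $\underline m_i>t$ implies $\overline p_i=0$; moreover the minimum and the maximum below exist and the bounds $$\min_{\nu\in\mathcal N}\ (\underline p_1,\dots,\underline p_{I_0^*})A_0^*\nu\ \le\ \Pr(z'y(p_0)\le t)\ \le\ \max_{\nu\in\mathcal N}\ (\overline p_1,\dots,\overline p_{I_0^*})A_0^*\nu$$ are sharp. -/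

import Mathlib

open MeasureTheory Set
open scoped Matrix

namespace RandomUtility

noncomputable section

/-- The budget plane `{y ∈ ℝ₊ᴷ : q'y = 1}` at the price vector `q` (expenditure is normalized
to one). -/
def budget {K : ℕ} (q : Fin K → ℝ) : Set (Fin K → ℝ) :=
  {y | 0 ≤ y ∧ q ⬝ᵥ y = 1}

/-- Local nonsatiation of a utility function on the consumption space `ℝ₊ᴷ`; values of `u`
outside the nonnegative orthant are irrelevant. -/
def LocallyNonsatiated {K : ℕ} (u : (Fin K → ℝ) → ℝ) : Prop :=
  ∀ y, 0 ≤ y → ∀ ε > 0, ∃ y', 0 ≤ y' ∧ dist y' y < ε ∧ u y < u y'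

/-- The utility maximizers at price `q`: the bundles on the budget plane that are at least as good
as every affordable bundle. -/
def demand {K : ℕ} (u : (Fin K → ℝ) → ℝ) (q : Fin K → ℝ) : Set (Fin K → ℝ) :=
  {y | y ∈ budget q ∧ ∀ y', 0 ≤ y' → q ⬝ᵥ y' ≤ 1 → u y' ≤ u y}

/-- A stochastic demand system `(P j)` on the budgets with prices `(p j)` is rationalizable by a
random utility model: there are a random locally nonsatiated utility function `u` and random demands
`y j`, with `y j` almost surely maximizing `u` on budget `j`, such that `y j` has law `P j`.
Utility functions carry the product (cylinder) σ-algebra. -/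
def Rationalizable {K : ℕ} {ι : Type} (p : ι → Fin K → ℝ) (P : ι → Measure (Fin K → ℝ)) : Prop :=
  ∃ (Ω : Type) (_ : MeasurableSpace Ω) (μ : Measure Ω) (u : Ω → (Fin K → ℝ) → ℝ)
    (y : ι → Ω → Fin K → ℝ),
    IsProbabilityMeasure μ ∧ Measurable u ∧ (∀ j, Measurable (y j)) ∧
    (∀ᵐ ω ∂μ, LocallyNonsatiated (u ω) ∧ ∀ j, y j ω ∈ demand (u ω) (p j)) ∧
    ∀ j, μ.map (y j) = P j

/-- A nonstochastic demand system `(d j)` is rationalizable: one locally nonsatiated utility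
function is maximized by `d j` on budget `j`, for all `j`. -/
def RationalizableChoices {K : ℕ} {ι : Type} (p : ι → Fin K → ℝ) (d : ι → Fin K → ℝ) : Prop :=
  ∃ u : (Fin K → ℝ) → ℝ, LocallyNonsatiated u ∧ ∀ j, d j ∈ demand u (p j)

/-- The position of `y` (below, on, above) relative to all budget planes. -/
def position {K : ℕ} {ι : Type} (p : ι → Fin K → ℝ) (y : Fin K → ℝ) : ι → SignType :=
  fun j => SignType.sign (p j ⬝ᵥ y - 1)

/-- The patches: the classes of the partition of `⋃ j, budget (p j)` according to the position
relative to all budget planes. -/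
def patches {K : ℕ} {ι : Type} (p : ι → Fin K → ℝ) : Set (Set (Fin K → ℝ)) :=
  {x | ∃ y₀ ∈ ⋃ j, budget (p j), x = {y | y ∈ ⋃ j, budget (p j) ∧ position p y = position p y₀}}

/-- The patches that comprise budget `j`. -/
def PatchOn {K : ℕ} {ι : Type} (p : ι → Fin K → ℝ) (j : ι) : Type :=
  {x : Set (Fin K → ℝ) // x ∈ patches p ∧ x ⊆ budget (p j)}

theorem finite_patches {K : ℕ} {ι : Type} [Finite ι] (p : ι → Fin K → ℝ) : (patches p).Finite := by
  refine (Set.finite_range (fun s : ι → SignType =>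
    {y | y ∈ ⋃ j, budget (p j) ∧ position p y = s})).subset ?_
  rintro x ⟨y₀, -, rfl⟩
  exact ⟨position p y₀, rfl⟩

instance instFinitePatchOn {K : ℕ} {ι : Type} [Finite ι] (p : ι → Fin K → ℝ) (j : ι) :
    Finite (PatchOn p j) :=
  ((finite_patches p).subset fun _ hx => hx.1).to_subtype

instance instFintypePatchOn {K : ℕ} {ι : Type} [Finite ι] (p : ι → Fin K → ℝ) (j : ι) :
    Fintype (PatchOn p j) :=
  Fintype.ofFinite _

open Classical in
/-- The binary vector representation of a nonstochastic demand system; the entries are indexed by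
the pairs of a budget and a patch on it. -/
def choiceVector {K : ℕ} {ι : Type} (p : ι → Fin K → ℝ) (d : ι → Fin K → ℝ) :
    (Σ j, PatchOn p j) → ℝ :=
  fun r => if d r.1 ∈ r.2.1 then 1 else 0

/-- The index set of the columns of the rational demand matrix: the vector representations of the
rationalizable nonstochastic demand systems, each listed once. -/
def RationalType {K : ℕ} {ι : Type} (p : ι → Fin K → ℝ) : Type :=
  {a : (Σ j, PatchOn p j) → ℝ // ∃ d, RationalizableChoices p d ∧ a = choiceVector p d}

instance instFiniteRationalType {K : ℕ} {ι : Type} [Finite ι] (p : ι → Fin K → ℝ) :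
    Finite (RationalType p) := by
  refine Set.Finite.to_subtype
    ((Set.Finite.pi' (fun _ : Σ j, PatchOn p j => Set.toFinite ({0, 1} : Set ℝ))).subset ?_)
  rintro a ⟨d, -, rfl⟩ r
  by_cases h : d r.1 ∈ r.2.1 <;> simp [choiceVector, h]

instance instFintypeRationalType {K : ℕ} {ι : Type} [Finite ι] (p : ι → Fin K → ℝ) :
    Fintype (RationalType p) :=
  Fintype.ofFinite _

/-- The rational demand matrix. -/
def demandMatrix {K : ℕ} {ι : Type} (p : ι → Fin K → ℝ) :
    Matrix (Σ j, PatchOn p j) (RationalType p) ℝ :=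
  fun r a => a.1 r

/-- The rows of the rational demand matrix that belong to the counterfactual budget `0`. -/
def A₀ {K J : ℕ} (p : Fin (J + 1) → Fin K → ℝ) : Matrix (PatchOn p 0) (RationalType p) ℝ :=
  (demandMatrix p).submatrix (fun i => ⟨0, i⟩) id

/-- The rows of the rational demand matrix that belong to the observed budgets `1, …, J`. -/
def A₁ {K J : ℕ} (p : Fin (J + 1) → Fin K → ℝ) :
    Matrix (Σ j : Fin J, PatchOn p j.succ) (RationalType p) ℝ :=
  (demandMatrix p).submatrix (fun r => ⟨r.1.succ, r.2⟩) id

/-- The probabilities of the patches on the observed budgets, as implied by the observed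
distributions of demand. -/
def π₁ {K J : ℕ} (p : Fin (J + 1) → Fin K → ℝ) (P : Fin J → Measure (Fin K → ℝ)) :
    (Σ j : Fin J, PatchOn p j.succ) → ℝ :=
  fun r => (P r.1).real r.2.1

/-- The feasible set of the linear programs: the vectors `ν` in the unit simplex with
`A₁ ν = π₁`. -/
def feasible {K J : ℕ} (p : Fin (J + 1) → Fin K → ℝ) (P : Fin J → Measure (Fin K → ℝ)) :
    Set (RationalType p → ℝ) :=
  {ν | ν ∈ stdSimplex ℝ (RationalType p) ∧ A₁ p *ᵥ ν = π₁ p P}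

/-- The distributions of counterfactual demand (on budget `0`) that are consistent with the
observed demand distributions `P`: those that are rationalizable jointly with `P`. -/
def consistent {K J : ℕ} (p : Fin (J + 1) → Fin K → ℝ) (P : Fin J → Measure (Fin K → ℝ)) :
    Set (Measure (Fin K → ℝ)) :=
  {P₀ | Rationalizable p (Fin.cons P₀ P : Fin (J + 1) → Measure (Fin K → ℝ))}

/-- The infimum of `z'y` over the set `x`, as an extended real number. -/
def mLower {K : ℕ} (z : Fin K → ℝ) (x : Set (Fin K → ℝ)) : EReal :=
  ⨅ y ∈ x, ((z ⬝ᵥ y : ℝ) : EReal)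

/-- The supremum of `z'y` over the set `x`, as an extended real number. -/
def mUpper {K : ℕ} (z : Fin K → ℝ) (x : Set (Fin K → ℝ)) : EReal :=
  ⨆ y ∈ x, ((z ⬝ᵥ y : ℝ) : EReal)

open Classical in
/-- The indicator of the event that the supremum of `z'y` over the patch is at most `t`. -/
def pLower {K J : ℕ} (p : Fin (J + 1) → Fin K → ℝ) (z : Fin K → ℝ) (t : ℝ) : PatchOn p 0 → ℝ :=
  fun i => if mUpper z i.1 ≤ (t : EReal) then 1 else 0

open Classical in
/-- The indicator of the event that the patch meets the half space `{z'y ≤ t}`. -/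
def pUpper {K J : ℕ} (p : Fin (J + 1) → Fin K → ℝ) (z : Fin K → ℝ) (t : ℝ) : PatchOn p 0 → ℝ :=
  fun i => if (i.1 ∩ {y | z ⬝ᵥ y ≤ t}).Nonempty then 1 else 0

open Classical in
/-- Objective of the lower linear program for an event `x`: the total probability of the patches on
budget `0` that are contained in `x`. -/
def eventLower {K J : ℕ} (p : Fin (J + 1) → Fin K → ℝ) (x : Set (Fin K → ℝ))
    (ν : RationalType p → ℝ) : ℝ :=
  ∑ i : PatchOn p 0 with i.1 ⊆ x, (A₀ p *ᵥ ν) i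

open Classical in
/-- Objective of the upper linear program for an event `x`: the total probability of the patches on
budget `0` that intersect `x`. -/
def eventUpper {K J : ℕ} (p : Fin (J + 1) → Fin K → ℝ) (x : Set (Fin K → ℝ))
    (ν : RationalType p → ℝ) : ℝ :=
  ∑ i : PatchOn p 0 with (i.1 ∩ x).Nonempty, (A₀ p *ᵥ ν) i

/-- The minimum of `lo` and the maximum of `up` over `F` exist, and they are sharp lower and upper
bounds for the values in `S`: valid bounds that cannot be improved. (For empty `S` this is false.) -/
def SharplyBounded {α : Type} (S : Set ℝ) (F : Set α) (lo up : α → ℝ) : Prop :=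
  ∃ L U : ℝ, IsLeast (lo '' F) L ∧ IsGreatest (up '' F) U ∧ IsGLB S L ∧ IsLUB S U

end

end RandomUtility

namespace RandomUtility

/-! Whether bundles chosen on their budgets are rationalizable depends only on the signs of `p i ⬝ᵥ
d j - 1`: it amounts to the existence of integer ranks compatible with revealed preference
(`IsRank`). Given such ranks, `rankUtility` rationalizes the choices, and it depends on prices and
ranks alone. Hence bundles may be moved freely inside their patches without changing the utility
function.

This reduces random demand to finitely many types. A rationalizable system of laws induces a
distribution `ν` of types whose patch probabilities are given by the demand matrix
(`exists_typeDistribution`). Conversely, `ν` together with any laws inside the patches yields a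
rationalizable system (`rationalizable_mixture`). Using the conditional laws of `P j` on the
observed budgets reproduces `P j` exactly, because `A₁ ν = π₁`. On budget `0` the law inside each
patch is free: mass can be put outside `x` unless the patch lies in `x`, and inside `x` as soon as
the patch meets it. So every value of either objective is a possible probability of `x`, and
compactness of the feasible set gives attained, sharp bounds. The half-space bounds are the case `x
= {y | z ⬝ᵥ y ≤ t}`.

Feasibility needs a separate argument, since the given utility may have no maximizer on budget `0`.
`exists_extension` builds a counterfactual choice from the ranks of the observed choices. -/

/-! ### Rank functions and rationalizability of nonstochastic systems -/

/-- `r` ranks the chosen bundles consistently with revealed preference; `s j i` is the position of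
the bundle chosen on budget `j` relative to budget `i`. -/
def IsRank {ι : Type} (s : ι → ι → SignType) (r : ι → ℕ) : Prop :=
  ∀ i j, (s j i ≤ 0 → r j ≤ r i) ∧ (s j i < 0 → r j < r i)

section Positions

variable {K : ℕ} {ι : Type} {p : ι → Fin K → ℝ}

theorem position_nonpos_iff {y : Fin K → ℝ} {i : ι} : position p y i ≤ 0 ↔ p i ⬝ᵥ y ≤ 1 := by
  rw [position, sign_nonpos_iff, sub_nonpos]

theorem position_neg_iff {y : Fin K → ℝ} {i : ι} : position p y i < 0 ↔ p i ⬝ᵥ y < 1 := by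
  rw [position, ← not_le, sign_nonneg_iff, sub_nonneg, not_le]

theorem position_eq_zero_iff {y : Fin K → ℝ} {i : ι} : position p y i = 0 ↔ p i ⬝ᵥ y = 1 := by
  rw [position, sign_eq_zero_iff, sub_eq_zero]

theorem dotProduct_one_pos_of_mem_budget {q y : Fin K → ℝ} (hq : 0 ≤ q) (hy : y ∈ budget q) :
    0 < q ⬝ᵥ 1 := by
  refine lt_of_le_of_ne (dotProduct_nonneg_of_nonneg hq zero_le_one) fun h => ?_
  rw [dotProduct_one, eq_comm, Finset.sum_eq_zero_iff_of_nonneg fun k _ => hq k] at h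
  have : q = 0 := funext fun k => h k (Finset.mem_univ k)
  simpa [this] using hy.2

theorem exists_isRank [Finite ι] {d : ι → Fin K → ℝ} (h : RationalizableChoices p d) :
    ∃ r, IsRank (fun j => position p (d j)) r := by
  classical
  have := Fintype.ofFinite ι
  obtain ⟨u, hu, hd⟩ := h
  -- Counting the chosen bundles of strictly lower utility turns real utility levels into natural
  -- ranks and preserves both weak and strict comparisons.
  refine ⟨fun i => (Finset.univ.filter fun k => u (d k) < u (d i)).card, fun i j => ?_⟩
  rw [position_nonpos_iff, position_neg_iff]
  constructor
  · intro hij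
    refine Finset.card_le_card fun k => ?_
    simp only [Finset.mem_filter, Finset.mem_univ, true_and]
    exact fun hk => hk.trans_le ((hd i).2 _ (hd j).1.1 hij)
  · intro hij
    -- Being strictly affordable is an open condition, so local nonsatiation supplies an affordable
    -- bundle better than `d j`.
    have hlt : u (d j) < u (d i) := by
      have ho : IsOpen {y : Fin K → ℝ | p i ⬝ᵥ y < 1} :=
        isOpen_lt (by unfold dotProduct; fun_prop) continuous_const
      obtain ⟨ε, hε, hb⟩ := Metric.isOpen_iff.1 ho (d j) hij
      obtain ⟨y, hy0, hyd, hyu⟩ := hu (d j) (hd j).1.1 ε hε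
      exact hyu.trans_le ((hd i).2 y hy0 (le_of_lt (hb hyd)))
    refine Finset.card_lt_card ((Finset.ssubset_iff_of_subset fun k => ?_).2 ⟨j, ?_, ?_⟩)
    · simp only [Finset.mem_filter, Finset.mem_univ, true_and]
      exact fun hk => hk.trans hlt
    · simpa using hlt
    · simp

end Positions

/-- A bounded, strictly monotone function of the total quantity of goods. -/
noncomputable def saturation {K : ℕ} (y : Fin K → ℝ) : ℝ :=
  1 - (1 + 1 ⬝ᵥ y)⁻¹

theorem saturation_nonneg {K : ℕ} {y : Fin K → ℝ} (hy : 0 ≤ y) : 0 ≤ saturation y := by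
  have : 0 ≤ 1 ⬝ᵥ y := dotProduct_nonneg_of_nonneg zero_le_one hy
  exact sub_nonneg.2 (inv_le_one_of_one_le₀ (by linarith))

theorem saturation_lt_one {K : ℕ} {y : Fin K → ℝ} (hy : 0 ≤ y) : saturation y < 1 := by
  have : 0 ≤ 1 ⬝ᵥ y := dotProduct_nonneg_of_nonneg zero_le_one hy
  exact sub_lt_self _ (by positivity)

theorem saturation_lt_saturation {K : ℕ} {y y' : Fin K → ℝ} (hy : 0 ≤ y)
    (h : 1 ⬝ᵥ y < 1 ⬝ᵥ y') : saturation y < saturation y' := by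
  have : 0 ≤ 1 ⬝ᵥ y := dotProduct_nonneg_of_nonneg zero_le_one hy
  exact sub_lt_sub_left (inv_strictAnti₀ (by linarith) (by linarith)) _

section RankUtility

variable {K : ℕ} {ι : Type} [Fintype ι]

/-- The bound on utility that budget `i` imposes when the bundle chosen on it has utility `r i`. -/
noncomputable def rankBound (p : ι → Fin K → ℝ) (r : ι → ℕ) (y : Fin K → ℝ) (i : ι) : ℝ :=
  if p i ⬝ᵥ y < 1 then r i - 1 + saturation y
  else if p i ⬝ᵥ y = 1 then r i
  else (∑ k, r k : ℕ) + 1 + saturation y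

/-- A locally nonsatiated utility function that rationalizes every system ranked by `r`. -/
noncomputable def rankUtility [Nonempty ι] (p : ι → Fin K → ℝ) (r : ι → ℕ) (y : Fin K → ℝ) : ℝ :=
  Finset.univ.inf' Finset.univ_nonempty (rankBound p r y)

theorem rank_le_sum (r : ι → ℕ) (i : ι) : (r i : ℝ) ≤ (∑ k, r k : ℕ) := by
  exact_mod_cast Finset.single_le_sum (f := r) (fun _ _ => Nat.zero_le _) (Finset.mem_univ i)

/-- Crossing a budget upwards never lowers its bound: below it the bound is less than `r i` because
`saturation` is less than one, and above it the bound exceeds every rank. Off the budget,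
`saturation` makes it strictly increasing, so the minimum over budgets has no local satiation point.
-/
theorem rankBound_lt {p : ι → Fin K → ℝ} {r : ι → ℕ} {y y' : Fin K → ℝ} {i : ι} (hy : 0 ≤ y)
    (hy' : 0 ≤ y') (h1 : 1 ⬝ᵥ y < 1 ⬝ᵥ y') (hi : p i ⬝ᵥ y < p i ⬝ᵥ y') :
    rankBound p r y i < rankBound p r y' i := by
  have := rank_le_sum r i
  have := saturation_lt_saturation hy h1
  have := saturation_lt_one hy
  have := saturation_nonneg hy'
  unfold rankBound
  split_ifs <;> linarith

theorem rankBound_le {p : ι → Fin K → ℝ} {r : ι → ℕ} {y : Fin K → ℝ} {i : ι} (hy : 0 ≤ y)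
    (h : p i ⬝ᵥ y ≤ 1) : rankBound p r y i ≤ r i := by
  have := saturation_lt_one hy
  unfold rankBound
  split_ifs with h1 h2
  · linarith
  · exact le_rfl
  · exact absurd (lt_of_le_of_ne h h2) h1

theorem locallyNonsatiated_rankUtility [Nonempty ι] {p : ι → Fin K → ℝ}
    (hp : ∀ i, 0 < p i ⬝ᵥ 1) (r : ι → ℕ) : LocallyNonsatiated (rankUtility p r) := by
  intro y hy ε hε
  have hy' : 0 ≤ y + (ε / 2) • (1 : Fin K → ℝ) := add_nonneg hy (smul_nonneg (by positivity) zero_le_one)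
  have h1 : 1 ⬝ᵥ y < 1 ⬝ᵥ (y + (ε / 2) • (1 : Fin K → ℝ)) := by
    obtain ⟨i⟩ := ‹Nonempty ι›
    have : 0 < (1 : Fin K → ℝ) ⬝ᵥ 1 := by
      rcases Nat.eq_zero_or_pos K with rfl | hK
      · simpa using hp i
      · simpa using hK
    rw [dotProduct_add, dotProduct_smul, smul_eq_mul]
    have := mul_pos (half_pos hε) this
    linarith
  refine ⟨_, hy', ?_, ?_⟩
  · refine lt_of_le_of_lt ((dist_pi_le_iff (half_pos hε).le).2 fun k => ?_) (half_lt_self hε)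
    simp [abs_of_pos hε]
  · refine (Finset.lt_inf'_iff _).2 fun i hi => (Finset.inf'_le _ hi).trans_lt ?_
    refine rankBound_lt hy hy' h1 ?_
    rw [dotProduct_add, dotProduct_smul, smul_eq_mul]
    have := mul_pos (half_pos hε) (hp i)
    linarith

/-- Budget `j` itself caps the utility of everything affordable there at `r j`, and the rank
inequalities say that no other budget caps `d j` below `r j`. The strict inequality gains a full
integer, which absorbs the `- 1` in `rankBound`. -/
theorem mem_demand_rankUtility [Nonempty ι] {p : ι → Fin K → ℝ} {d : ι → Fin K → ℝ} {r : ι → ℕ}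
    (hd : ∀ j, d j ∈ budget (p j)) (hr : IsRank (fun j => position p (d j)) r) (j : ι) :
    d j ∈ demand (rankUtility p r) (p j) := by
  refine ⟨hd j, fun y hy hyj => ?_⟩
  refine (Finset.inf'_le _ (Finset.mem_univ j)).trans ((rankBound_le hy hyj).trans ?_)
  refine Finset.le_inf' _ _ fun i _ => ?_
  have := rank_le_sum r j
  have := saturation_nonneg (hd j).1
  obtain ⟨h1, h2⟩ := hr i j
  rw [position_nonpos_iff] at h1
  rw [position_neg_iff] at h2
  unfold rankBound
  split_ifs with h3 h4
  · have : ((r j + 1 : ℕ) : ℝ) ≤ r i := by exact_mod_cast h2 h3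
    push_cast at this
    linarith
  · exact_mod_cast h1 h4.le
  · linarith

theorem rationalizableChoices_of_isRank [Nonempty ι] {p : ι → Fin K → ℝ} (hp : ∀ j, 0 ≤ p j)
    {d : ι → Fin K → ℝ} {r : ι → ℕ} (hd : ∀ j, d j ∈ budget (p j))
    (hr : IsRank (fun j => position p (d j)) r) : RationalizableChoices p d :=
  ⟨rankUtility p r,
    locallyNonsatiated_rankUtility (fun i => dotProduct_one_pos_of_mem_budget (hp i) (hd i)) r,
    mem_demand_rankUtility hd hr⟩

end RankUtility

/-! ### Extension to an additional budget -/

theorem exists_mem_budget {K : ℕ} {q y : Fin K → ℝ} (hq : 0 < q ⬝ᵥ 1) (hy : 0 ≤ y)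
    (h : q ⬝ᵥ y < 1) : ∃ s : ℝ, 0 < s ∧ y + s • 1 ∈ budget q := by
  have hs : 0 < (1 - q ⬝ᵥ y) / (q ⬝ᵥ 1) := div_pos (sub_pos.2 h) hq
  refine ⟨_, hs, add_nonneg hy (smul_nonneg hs.le zero_le_one), ?_⟩
  rw [dotProduct_add, dotProduct_smul, smul_eq_mul, div_mul_cancel₀ _ hq.ne']
  ring

/-- There is a bundle on budget `0`, chosen as a function of the ranking alone, that extends every
system ranked by `r` to a rationalizable one. -/
theorem exists_extension {K J : ℕ} {p : Fin (J + 1) → Fin K → ℝ} (hp : ∀ j, 0 ≤ p j)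
    (hp0 : p 0 ≠ 0) (r : Fin J → ℕ) :
    ∃ d₀ : Fin K → ℝ, ∀ d : Fin J → Fin K → ℝ, (∀ j, d j ∈ budget (p j.succ)) →
      IsRank (fun j => position (fun j => p (Fin.succ j)) (d j)) r →
      RationalizableChoices p (Fin.cons d₀ d : Fin (J + 1) → Fin K → ℝ) := by
  classical
  have hp01 : 0 < p 0 ⬝ᵥ 1 := by
    refine lt_of_le_of_ne (dotProduct_nonneg_of_nonneg (hp 0) zero_le_one) fun h => hp0 ?_
    rw [dotProduct_one, eq_comm, Finset.sum_eq_zero_iff_of_nonneg fun k _ => hp 0 k] at h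
    exact funext fun k => h k (Finset.mem_univ k)
  -- Old ranks will be doubled to `2 * r i + 2`, leaving odd values free for the new bundle. `Q n`
  -- says that some bundle on budget `0` can take rank `n` without violating what the old budgets
  -- reveal about it. The largest such `n` also respects what budget `0` reveals about the old
  -- bundles.
  let Q : ℕ → Prop := fun n => ∃ y ∈ budget (p 0), ∀ i : Fin J,
    (p i.succ ⬝ᵥ y < 1 → n ≤ 2 * r i + 1) ∧ (p i.succ ⬝ᵥ y ≤ 1 → n ≤ 2 * r i + 2)
  -- The search range must contain `2 * r j + 3` for each `j`, the largest value for which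
  -- maximality is invoked.
  let M := 2 * (∑ k, r k) + 3
  have hQ0 : Q 0 := by
    obtain ⟨s, -, hs⟩ := exists_mem_budget hp01 le_rfl (by simp)
    exact ⟨_, hs, fun i => ⟨fun _ => Nat.zero_le _, fun _ => Nat.zero_le _⟩⟩
  obtain ⟨d₀, hd₀, hn⟩ : Q (Nat.findGreatest Q M) := Nat.findGreatest_spec (Nat.zero_le M) hQ0
  set n := Nat.findGreatest Q M with hndef
  refine ⟨d₀, fun d hd hr => ?_⟩
  have hM : ∀ j, 2 * r j + 3 ≤ M := fun j => by
    have := Finset.single_le_sum (f := r) (fun _ _ => Nat.zero_le _) (Finset.mem_univ j)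
    omega
  refine rationalizableChoices_of_isRank hp (r := (Fin.cons n fun j => 2 * r j + 2)) ?_ ?_
  · intro j
    cases j using Fin.cases with
    | zero => exact hd₀
    | succ j => exact hd j
  · intro i j
    rw [position_nonpos_iff, position_neg_iff]
    cases i using Fin.cases with
    | zero =>
      cases j using Fin.cases with
      | zero => exact ⟨fun _ => le_rfl, fun h => absurd hd₀.2 h.ne⟩
      | succ j =>
        simp only [Fin.cons_zero, Fin.cons_succ]
        -- Raising all goods moves `d j` onto budget `0`. If the raised bundle is still affordable
        -- at `i`, then `d j` was strictly affordable there, so `r j < r i`; hence the raised bundle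
        -- witnesses `Q (2 * r j + 3)`.
        have hlt : p 0 ⬝ᵥ d j < 1 → 2 * r j + 2 < n := fun h => by
          obtain ⟨s, hs, hmem⟩ := exists_mem_budget hp01 (hd j).1 h
          refine Nat.le_findGreatest (hM j) ⟨_, hmem, fun i => ?_⟩
          have hi : p i.succ ⬝ᵥ (d j + s • 1) ≤ 1 → r j < r i := fun h' => by
            refine (hr i j).2 (position_neg_iff.2 ?_)
            have := mul_pos hs (dotProduct_one_pos_of_mem_budget (hp _) (hd i))
            rw [dotProduct_add, dotProduct_smul, smul_eq_mul] at h'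
            linarith
          exact ⟨fun h' => by have := hi h'.le; omega, fun h' => by have := hi h'; omega⟩
        refine ⟨fun h => ?_, hlt⟩
        rcases h.lt_or_eq with h | h
        · exact (hlt h).le
        -- Here `d j` lies on budget `0` and is itself a witness of `Q (2 * r j + 2)`.
        · refine Nat.le_findGreatest ((hM j).trans' (by omega)) ⟨d j, ⟨(hd j).1, h⟩, fun i => ?_⟩
          obtain ⟨h1, h2⟩ := hr i j
          rw [position_nonpos_iff] at h1
          rw [position_neg_iff] at h2
          exact ⟨fun h' => by have := h2 h'; omega, fun h' => by have := h1 h'; omega⟩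
    | succ i =>
      cases j using Fin.cases with
      | zero =>
        simp only [Fin.cons_zero, Fin.cons_succ]
        exact ⟨(hn i).2, fun h => Nat.lt_succ_of_le ((hn i).1 h)⟩
      | succ j =>
        simp only [Fin.cons_succ]
        obtain ⟨h1, h2⟩ := hr i j
        rw [position_nonpos_iff] at h1
        rw [position_neg_iff] at h2
        exact ⟨fun h => by have := h1 h; omega, fun h => by have := h2 h; omega⟩

/-! ### Patches -/

section Patches

variable {K : ℕ} {ι : Type} {p : ι → Fin K → ℝ}

theorem mem_patchOn_iff {j : ι} (i : PatchOn p j) :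
    ∃ y₀ ∈ ⋃ j, budget (p j), ∀ y, y ∈ i.1 ↔ y ∈ ⋃ j, budget (p j) ∧ position p y = position p y₀ := by
  obtain ⟨_, ⟨y₀, h, rfl⟩, -⟩ := i
  exact ⟨y₀, h, fun _ => Iff.rfl⟩

theorem nonempty_of_patchOn {j : ι} (i : PatchOn p j) : i.1.Nonempty := by
  obtain ⟨y₀, h, hi⟩ := mem_patchOn_iff i
  exact ⟨y₀, (hi y₀).2 ⟨h, rfl⟩⟩

theorem position_eq_of_mem_patchOn {j : ι} {i : PatchOn p j} {y y' : Fin K → ℝ} (hy : y ∈ i.1)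
    (hy' : y' ∈ i.1) : position p y = position p y' := by
  obtain ⟨y₀, -, hi⟩ := mem_patchOn_iff i
  exact ((hi y).1 hy).2.trans ((hi y').1 hy').2.symm

theorem exists_mem_patchOn {j : ι} {y : Fin K → ℝ} (hy : y ∈ budget (p j)) :
    ∃ i : PatchOn p j, y ∈ i.1 := by
  have hU : y ∈ ⋃ j, budget (p j) := mem_iUnion.2 ⟨j, hy⟩
  refine ⟨⟨_, ⟨y, hU, rfl⟩, ?_⟩, hU, rfl⟩
  rintro y' ⟨h, h'⟩
  obtain ⟨k, hk⟩ := mem_iUnion.1 h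
  refine ⟨hk.1, ?_⟩
  rw [← position_eq_zero_iff (p := p), h', position_eq_zero_iff]
  exact hy.2

theorem patchOn_eq_of_mem {j : ι} {i i' : PatchOn p j} {y : Fin K → ℝ} (hy : y ∈ i.1)
    (hy' : y ∈ i'.1) : i = i' := by
  obtain ⟨y₀, -, hi⟩ := mem_patchOn_iff i
  obtain ⟨y₁, -, hi'⟩ := mem_patchOn_iff i'
  refine Subtype.ext (Set.ext fun y' => ?_)
  rw [hi, hi', ← ((hi y).1 hy).2, ← ((hi' y).1 hy').2]

theorem disjoint_patchOn {j : ι} {i i' : PatchOn p j} (h : i ≠ i') : Disjoint i.1 i'.1 :=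
  Set.disjoint_left.2 fun _ hy hy' => h (patchOn_eq_of_mem hy hy')

theorem iUnion_patchOn (j : ι) : ⋃ i : PatchOn p j, i.1 = budget (p j) :=
  subset_antisymm (iUnion_subset fun i => i.2.2) fun _ hy => mem_iUnion.2 (exists_mem_patchOn hy)

theorem measurable_dotProduct (q : Fin K → ℝ) : Measurable fun y => q ⬝ᵥ y := by
  unfold dotProduct
  fun_prop

theorem measurableSet_budget (q : Fin K → ℝ) : MeasurableSet (budget q) :=
  (measurableSet_le measurable_const measurable_id).inter
    (measurable_dotProduct q (measurableSet_singleton 1))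

theorem measurableSet_position_eq [Finite ι] (s : ι → SignType) :
    MeasurableSet {y | position p y = s} := by
  have : {y | position p y = s} = ⋂ j, {y | SignType.sign (p j ⬝ᵥ y - 1) = s j} := by
    ext y
    simp only [mem_iInter]
    exact funext_iff
  rw [this]
  refine MeasurableSet.iInter fun j => ?_
  have hm : Measurable fun y => p j ⬝ᵥ y - 1 := (measurable_dotProduct (p j)).sub_const 1
  cases s j
  · exact (hm (measurableSet_singleton 0)).congr (ext fun y => sign_eq_zero_iff.symm)
  · exact (hm measurableSet_Iio).congr
      (ext fun y => (sign_eq_neg_one_iff (a := p j ⬝ᵥ y - 1)).symm)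
  · exact (hm measurableSet_Ioi).congr (ext fun y => (sign_eq_one_iff (a := p j ⬝ᵥ y - 1)).symm)

theorem measurableSet_patchOn [Finite ι] {j : ι} (i : PatchOn p j) : MeasurableSet i.1 := by
  obtain ⟨y₀, -, hi⟩ := mem_patchOn_iff i
  exact ((MeasurableSet.iUnion fun j => measurableSet_budget (p j)).inter
    (measurableSet_position_eq (position p y₀))).congr (ext fun y => (hi y).symm)

/-! ### The distribution of the types of a random rationalizable system -/

theorem measurable_choiceVector [Finite ι] : Measurable (choiceVector p) := by
  classical
  refine measurable_pi_lambda _ fun r => ?_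
  exact Measurable.ite ((measurable_pi_apply r.1) (measurableSet_patchOn r.2)) measurable_const
    measurable_const

theorem exists_typeDistribution [Finite ι] {Ω : Type*} [MeasurableSpace Ω] {μ : Measure Ω}
    [IsProbabilityMeasure μ] {d : Ω → ι → Fin K → ℝ} (hd : Measurable d)
    (h : ∀ᵐ ω ∂μ, RationalizableChoices p (d ω)) :
    ∃ ν ∈ stdSimplex ℝ (RationalType p),
      ∀ r, (demandMatrix p *ᵥ ν) r = μ.real {ω | d ω r.1 ∈ r.2.1} := by
  classical
  let E : RationalType p → Set Ω := fun a => {ω | choiceVector p (d ω) = a.1}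
  have hE : ∀ a, MeasurableSet (E a) := fun a =>
    (measurable_choiceVector.comp hd) (measurableSet_singleton a.1)
  -- The events `E a` are disjoint and cover almost every `ω`, so an event whose indicator is
  -- constant on each of them has the corresponding weighted probability.
  have key : ∀ S : Set Ω, MeasurableSet S → ∀ c : RationalType p → ℝ,
      (∀ a, ∀ ω ∈ E a, S.indicator 1 ω = c a) → μ.real S = ∑ a, c a * μ.real (E a) := by
    intro S hS c hc
    rw [← integral_indicator_one hS]
    have : ∀ᵐ ω ∂μ, S.indicator (1 : Ω → ℝ) ω = ∑ a, c a * (E a).indicator (1 : Ω → ℝ) ω := by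
      filter_upwards [h] with ω hω
      let a : RationalType p := ⟨choiceVector p (d ω), d ω, hω, rfl⟩
      rw [Finset.sum_eq_single a]
      · rw [hc a ω rfl, indicator_of_mem (show ω ∈ E a from rfl)]
        simp
      · intro b _ hb
        rw [indicator_of_notMem, mul_zero]
        exact fun hω' => hb (Subtype.ext (Eq.symm hω'))
      · exact fun h => absurd (Finset.mem_univ a) h
    rw [integral_congr_ae this, integral_finsetSum]
    · refine Finset.sum_congr rfl fun a _ => ?_
      rw [integral_const_mul, integral_indicator_one (hE a)]
    · exact fun a _ => ((integrable_const (1 : ℝ)).indicator (hE a)).const_mul _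
  refine ⟨fun a => μ.real (E a), ⟨fun a => measureReal_nonneg, ?_⟩, fun r => ?_⟩
  · have := key univ MeasurableSet.univ (fun _ => 1) (by simp)
    simpa using this.symm
  · have hm : Measurable fun ω => d ω r.1 := (measurable_pi_apply r.1).comp hd
    rw [key {ω | d ω r.1 ∈ r.2.1} (hm (measurableSet_patchOn r.2)) (fun a => a.1 r)]
    · rfl
    · intro a ω hω
      rw [← show choiceVector p (d ω) = a.1 from hω]
      simp [choiceVector, indicator_apply]

/-! ### Rationalizing a distribution of types -/

/-- A type names one patch per budget, and positions are constant on patches, so a single ranking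
serves every selection from them. -/
theorem exists_patch_rank [Finite ι] (a : RationalType p) :
    ∃ (f : ∀ j, PatchOn p j) (r : ι → ℕ), (∀ j i, a.1 ⟨j, i⟩ = Set.indicator {f j} 1 i) ∧
      ∀ d : ι → Fin K → ℝ, (∀ j, d j ∈ (f j).1) → IsRank (fun j => position p (d j)) r := by
  obtain ⟨_, d, hd, rfl⟩ := a
  obtain ⟨r, hr⟩ := exists_isRank hd
  obtain ⟨u, -, hu⟩ := hd
  choose f hf using fun j => exists_mem_patchOn (hu j).1
  refine ⟨f, r, fun j i => ?_, fun d' hd' => ?_⟩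
  · classical
    rw [indicator_apply]
    refine if_congr ⟨fun h => patchOn_eq_of_mem h (hf j), ?_⟩ rfl rfl
    rintro rfl
    exact hf j
  · convert hr using 2 with j
    exact position_eq_of_mem_patchOn (hd' j) (hf j)

/-- Draw a type from `ν`, then a bundle from each of its patches. The utility depends on the type
alone. Drawing independently across budgets is harmless, since every selection from the patches is
rationalized and only the marginals are prescribed. -/
theorem rationalizable_mixture [Fintype ι] [Nonempty ι] (hp : ∀ j, 0 ≤ p j)
    {ν : RationalType p → ℝ} (hν : ν ∈ stdSimplex ℝ (RationalType p))
    (Q : ∀ j, PatchOn p j → Measure (Fin K → ℝ)) [∀ j i, IsProbabilityMeasure (Q j i)]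
    (hQ : ∀ j i, ∀ᵐ y ∂Q j i, y ∈ i.1) :
    Rationalizable p fun j =>
      ∑ i, ENNReal.ofReal ((demandMatrix p *ᵥ ν) ⟨j, i⟩) • Q j i := by
  classical
  choose f r hf hr using exists_patch_rank (p := p)
  let _ : MeasurableSpace (RationalType p) := ⊤
  let μ : Measure (RationalType p × (ι → Fin K → ℝ)) :=
    ∑ a, ENNReal.ofReal (ν a) • (Measure.pi fun j => Q j (f a j)).map (Prod.mk a)
  have hmk : ∀ a : RationalType p, Measurable (Prod.mk a : (ι → Fin K → ℝ) → _) := fun a =>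
    measurable_prodMk_left
  refine ⟨RationalType p × (ι → Fin K → ℝ), inferInstance, μ, fun ω => rankUtility p (r ω.1),
    fun j ω => ω.2 j, ⟨?_⟩, ?_, fun j => by fun_prop, ?_, fun j => ?_⟩
  · simp only [μ, Measure.coe_finsetSum, Finset.sum_apply, Measure.smul_apply, smul_eq_mul]
    calc ∑ a, ENNReal.ofReal (ν a) * _ = ∑ a, ENNReal.ofReal (ν a) :=
          Finset.sum_congr rfl fun a _ => by
            rw [Measure.map_apply (hmk a) MeasurableSet.univ, preimage_univ, measure_univ, mul_one]
      _ = 1 := by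
        rw [← ENNReal.ofReal_sum_of_nonneg fun a _ => hν.1 a, hν.2, ENNReal.ofReal_one]
  · exact (measurable_from_top (f := fun a => rankUtility p (r a))).comp measurable_fst
  · rw [ae_iff]
    simp only [μ, Measure.coe_finsetSum, Finset.sum_apply, Measure.smul_apply, smul_eq_mul]
    refine Finset.sum_eq_zero fun a _ => ?_
    rw [mul_eq_zero]
    right
    rw [← ae_iff]
    have hae : ∀ᵐ d ∂Measure.pi fun j => Q j (f a j), ∀ j, d j ∈ (f a j).1 :=
      ae_all_iff.2 fun j => (measurePreserving_eval (fun j => Q j (f a j)) j).quasiMeasurePreserving.ae (hQ j (f a j))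
    have hset : MeasurableSet
        {ω : RationalType p × (ι → Fin K → ℝ) | ω.1 = a ∧ ∀ j, ω.2 j ∈ (f a j).1} := by
      have h1 : MeasurableSet (Prod.fst ⁻¹' {a} : Set (RationalType p × (ι → Fin K → ℝ))) :=
        measurable_fst (MeasurableSpace.measurableSet_top (s := {a}))
      have h2 : MeasurableSet
          (⋂ j, {ω : RationalType p × (ι → Fin K → ℝ) | ω.2 j ∈ (f a j).1}) :=
        MeasurableSet.iInter fun j =>
          ((measurable_pi_apply j).comp measurable_snd) (measurableSet_patchOn (f a j))
      refine (h1.inter h2).congr (ext fun ω => ?_)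
      rw [mem_inter_iff, mem_iInter]
      rfl
    have : ∀ᵐ ω ∂(Measure.pi fun j => Q j (f a j)).map (Prod.mk a), ω.1 = a ∧ ∀ j, ω.2 j ∈ (f a j).1 := by
      rw [ae_map_iff (hmk a).aemeasurable hset]
      filter_upwards [hae] with d hd using ⟨rfl, hd⟩
    filter_upwards [this] with ω hω
    obtain ⟨b, d⟩ := ω
    obtain ⟨rfl, hd⟩ := hω
    have hb : ∀ j, d j ∈ budget (p j) := fun j => (f b j).2.2 (hd j)
    exact ⟨locallyNonsatiated_rankUtility
      (fun i => dotProduct_one_pos_of_mem_budget (hp i) (hb i)) _,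
      mem_demand_rankUtility hb (hr b d hd)⟩
  · have hj : Measurable fun ω : RationalType p × (ι → Fin K → ℝ) => ω.2 j := by fun_prop
    ext s hs
    rw [Measure.map_apply hj hs]
    simp only [μ, Measure.coe_finsetSum, Finset.sum_apply, Measure.smul_apply, smul_eq_mul]
    have h1 : ∀ a, (Measure.pi fun j => Q j (f a j)).map (Prod.mk a) ((fun ω => ω.2 j) ⁻¹' s)
        = Q j (f a j) s := fun a => by
      rw [Measure.map_apply (hmk a) (hj hs)]
      exact (measurePreserving_eval (fun j => Q j (f a j)) j).measure_preimage hs.nullMeasurableSet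
    -- The probability of a patch is the `ν`-mass of the types that select it.
    have h2 : ∀ i, ENNReal.ofReal ((demandMatrix p *ᵥ ν) ⟨j, i⟩)
        = ∑ a, ENNReal.ofReal (ν a) * Set.indicator {f a j} 1 i := fun i => by
      simp only [Matrix.mulVec, dotProduct, demandMatrix, hf]
      have hnn : ∀ a, (0 : ℝ) ≤ indicator {f a j} 1 i := fun a =>
        indicator_nonneg (fun _ _ => zero_le_one) _
      rw [ENNReal.ofReal_sum_of_nonneg fun a _ => mul_nonneg (hnn a) (hν.1 a)]
      refine Finset.sum_congr rfl fun a _ => ?_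
      by_cases h : i = f a j <;> simp [h]
    simp only [h1, h2, Finset.sum_mul]
    rw [Finset.sum_comm]
    refine Finset.sum_congr rfl fun a _ => ?_
    rw [Finset.sum_eq_single (f a j)]
    · simp
    · intro i _ hi
      simp [hi]
    · exact fun h => absurd (Finset.mem_univ _) h

end Patches

/-! ### Consistent counterfactual distributions and the feasible set -/

theorem Rationalizable.isProbabilityMeasure {K : ℕ} {ι : Type} {p : ι → Fin K → ℝ}
    {P : ι → Measure (Fin K → ℝ)} (h : Rationalizable p P) (j : ι) :
    IsProbabilityMeasure (P j) := by
  obtain ⟨Ω, _, μ, u, y, _, -, hy, -, hP⟩ := h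
  rw [← hP j]
  exact Measure.isProbabilityMeasure_map (hy j).aemeasurable

theorem Rationalizable.ae_mem_budget {K : ℕ} {ι : Type} {p : ι → Fin K → ℝ}
    {P : ι → Measure (Fin K → ℝ)} (h : Rationalizable p P) (j : ι) :
    ∀ᵐ y ∂P j, y ∈ budget (p j) := by
  obtain ⟨Ω, _, μ, u, y, _, -, hy, hd, hP⟩ := h
  rw [← hP j]
  refine (ae_map_iff (hy j).aemeasurable (measurableSet_budget _)).2 ?_
  filter_upwards [hd] with ω hω using (hω.2 j).1

variable {K J : ℕ} {p : Fin (J + 1) → Fin K → ℝ} {P : Fin J → Measure (Fin K → ℝ)}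

theorem exists_feasible_of_mem_consistent {P₀ : Measure (Fin K → ℝ)} (h : P₀ ∈ consistent p P) :
    ∃ ν ∈ feasible p P, ∀ i, (A₀ p *ᵥ ν) i = P₀.real i.1 := by
  obtain ⟨Ω, _, μ, u, y, _, -, hy, hd, hP⟩ := h
  obtain ⟨ν, hν, hr⟩ := exists_typeDistribution (p := p) (μ := μ) (d := fun ω j => y j ω)
    (measurable_pi_lambda _ hy) (hd.mono fun ω hω => ⟨u ω, hω⟩)
  have hr' : ∀ j (i : PatchOn p j), (demandMatrix p *ᵥ ν) ⟨j, i⟩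
      = ((Fin.cons P₀ P : Fin (J + 1) → Measure (Fin K → ℝ)) j).real i.1 := fun j i => by
    rw [hr, ← hP j, map_measureReal_apply (hy j) (measurableSet_patchOn i)]
    rfl
  exact ⟨ν, ⟨hν, funext fun r => hr' r.1.succ r.2⟩, fun i => hr' 0 i⟩

theorem feasible_nonempty (hp : ∀ j, 0 ≤ p j) (hp0 : p 0 ≠ 0)
    (hP : Rationalizable (fun j => p j.succ) P) : (feasible p P).Nonempty := by
  classical
  obtain ⟨Ω, _, μ, u, y, _, -, hy, hd, hP⟩ := hP
  choose D hD using exists_extension hp hp0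
  -- The counterfactual choice is a function of the finite sign pattern of the observed choices,
  -- which makes it measurable without any measurable selection. The default `0` occurs only for
  -- patterns without a ranking, a null event.
  let G : (Fin J → Fin J → SignType) → Fin K → ℝ := fun t =>
    if h : ∃ r, IsRank t r then D h.choose else 0
  let pat : Ω → Fin J → Fin J → SignType := fun ω j => position (fun j => p (Fin.succ j)) (y j ω)
  have hG : Measurable fun ω => G (pat ω) := by
    let _ : MeasurableSpace (Fin J → Fin J → SignType) := ⊤
    suffices h : Measurable pat from (measurable_from_top (f := G)).comp h
    refine measurable_to_countable' fun t => ?_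
    have : pat ⁻¹' {t} = ⋂ j, y j ⁻¹' {y | position (fun j => p (Fin.succ j)) y = t j} := by
      ext ω
      rw [mem_iInter]
      exact funext_iff
    rw [this]
    exact MeasurableSet.iInter fun j => hy j (measurableSet_position_eq _)
  let d : Ω → Fin (J + 1) → Fin K → ℝ := fun ω => Fin.cons (G (pat ω)) fun j => y j ω
  have hdm : Measurable d := measurable_pi_lambda _ fun j => by
    cases j using Fin.cases with
    | zero => exact hG
    | succ j => exact hy j
  obtain ⟨ν, hν, hr⟩ := exists_typeDistribution (p := p) (μ := μ) hdm <| by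
    filter_upwards [hd] with ω hω
    have hex : ∃ r, IsRank (pat ω) r := exists_isRank ⟨u ω, hω⟩
    have hGω : G (pat ω) = D hex.choose := dif_pos hex
    change RationalizableChoices p (Fin.cons (G (pat ω)) fun j => y j ω)
    rw [hGω]
    exact hD _ _ (fun j => (hω.2 j).1) hex.choose_spec
  refine ⟨ν, hν, funext fun r => (hr _).trans ?_⟩
  rw [π₁, ← hP r.1, map_measureReal_apply (hy r.1) (measurableSet_patchOn r.2)]
  rfl

theorem isCompact_feasible : IsCompact (feasible p P) := by
  refine (isCompact_stdSimplex ℝ (RationalType p)).inter_right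
    (t := {ν | A₁ p *ᵥ ν = π₁ p P}) (isClosed_eq ?_ continuous_const)
  exact Continuous.matrix_mulVec continuous_const continuous_id

theorem demandMatrix_mulVec_nonneg {ι : Type} [Finite ι] {p : ι → Fin K → ℝ}
    {ν : RationalType p → ℝ} (hν : 0 ≤ ν) (r : Σ j, PatchOn p j) :
    0 ≤ (demandMatrix p *ᵥ ν) r := by
  refine dotProduct_nonneg_of_nonneg (fun a => ?_) hν
  obtain ⟨_, d, -, rfl⟩ := a
  change (0 : ℝ) ≤ choiceVector p d r
  unfold choiceVector
  split_ifs <;> norm_num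

/-- The conditional distribution on a patch; a point mass if the patch is a null set. -/
theorem exists_conditional {ι : Type} [Finite ι] {p : ι → Fin K → ℝ} {j : ι}
    (P : Measure (Fin K → ℝ)) [IsProbabilityMeasure P] (i : PatchOn p j) :
    ∃ Q : Measure (Fin K → ℝ), IsProbabilityMeasure Q ∧ (∀ᵐ y ∂Q, y ∈ i.1) ∧
      P i.1 • Q = P.restrict i.1 := by
  by_cases h : P i.1 = 0
  · obtain ⟨y, hy⟩ := nonempty_of_patchOn i
    refine ⟨Measure.dirac y, inferInstance, (ae_dirac_iff (measurableSet_patchOn i)).2 hy, ?_⟩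
    rw [h, zero_smul, Measure.restrict_eq_zero.2 h]
  · refine ⟨ProbabilityTheory.cond P i.1, ProbabilityTheory.cond_isProbabilityMeasure h,
      ProbabilityTheory.ae_cond_mem (measurableSet_patchOn i), ?_⟩
    rw [ProbabilityTheory.cond, smul_smul, ENNReal.mul_inv_cancel h (measure_ne_top _ _), one_smul]

theorem sum_restrict_patchOn {ι : Type} [Finite ι] {p : ι → Fin K → ℝ} {j : ι}
    {P : Measure (Fin K → ℝ)} (hP : ∀ᵐ y ∂P, y ∈ budget (p j)) :
    ∑ i : PatchOn p j, P.restrict i.1 = P := by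
  rw [← Measure.sum_fintype, ← Measure.restrict_iUnion (fun _ _ => disjoint_patchOn)
    measurableSet_patchOn, iUnion_patchOn, Measure.restrict_eq_self_of_ae_mem hP]

/-- Every feasible weighting of the types generates a consistent counterfactual distribution, with
demand on budget `0` concentrated on an arbitrary selection of one bundle from each patch. -/
theorem sum_dirac_mem_consistent (hp : ∀ j, 0 ≤ p j)
    (hP : Rationalizable (fun j => p j.succ) P) {ν : RationalType p → ℝ} (hν : ν ∈ feasible p P)
    {q : PatchOn p 0 → Fin K → ℝ} (hq : ∀ i, q i ∈ i.1) :
    ∑ i, ENNReal.ofReal ((A₀ p *ᵥ ν) i) • Measure.dirac (q i) ∈ consistent p P := by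
  have := hP.isProbabilityMeasure
  choose Q hQ1 hQ2 hQ3 using fun (j : Fin J) (i : PatchOn p j.succ) => exists_conditional (P j) i
  let T : ∀ j, PatchOn p j → Measure (Fin K → ℝ) :=
    Fin.cases (fun i => Measure.dirac (q i)) Q
  have hT1 : ∀ j i, IsProbabilityMeasure (T j i) := fun j => by
    cases j using Fin.cases with
    | zero => exact fun i => Measure.dirac.isProbabilityMeasure
    | succ j => exact hQ1 j
  have hT2 : ∀ j i, ∀ᵐ y ∂T j i, y ∈ i.1 := fun j => by
    cases j using Fin.cases with
    | zero => exact fun i => (ae_dirac_iff (measurableSet_patchOn i)).2 (hq i)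
    | succ j => exact hQ2 j
  change Rationalizable p _
  convert rationalizable_mixture hp hν.1 T hT2 using 1
  funext j
  cases j using Fin.cases with
  | zero => rfl
  | succ j =>
    change P j = ∑ i : PatchOn p j.succ, ENNReal.ofReal ((A₁ p *ᵥ ν) ⟨j, i⟩) • Q j i
    rw [hν.2]
    conv_lhs => rw [← sum_restrict_patchOn (hP.ae_mem_budget j)]
    refine Finset.sum_congr rfl fun i _ => ?_
    rw [π₁, ofReal_measureReal]
    exact (hQ3 j i).symm

theorem real_sum_dirac {ν : RationalType p → ℝ} (hν : 0 ≤ ν)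
    (q : PatchOn p 0 → Fin K → ℝ) {x : Set (Fin K → ℝ)} (hx : MeasurableSet x) [DecidablePred fun i => q i ∈ x] :
    (∑ i, ENNReal.ofReal ((A₀ p *ᵥ ν) i) • Measure.dirac (q i)).real x
      = ∑ i with q i ∈ x, (A₀ p *ᵥ ν) i := by
  have h0 : ∀ i, 0 ≤ (A₀ p *ᵥ ν) i := fun i => demandMatrix_mulVec_nonneg hν ⟨0, i⟩
  rw [measureReal_def]
  simp only [Measure.coe_finsetSum, Finset.sum_apply, Measure.smul_apply, smul_eq_mul,
    Measure.dirac_apply' _ hx]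
  rw [ENNReal.toReal_sum, Finset.sum_filter]
  · refine Finset.sum_congr rfl fun i _ => ?_
    by_cases h : q i ∈ x <;> simp [h, h0 i]
  · intro i _
    by_cases h : q i ∈ x <;> simp [h]

/-! ### Sharp bounds -/

theorem sharplyBounded_of_attained {α : Type} [TopologicalSpace α] {S : Set ℝ} {F : Set α}
    {lo up : α → ℝ} (hF : IsCompact F) (hne : F.Nonempty) (hlo : Continuous lo)
    (hup : Continuous up) (hloS : ∀ ν ∈ F, lo ν ∈ S) (hupS : ∀ ν ∈ F, up ν ∈ S)
    (h : ∀ s ∈ S, ∃ ν ∈ F, lo ν ≤ s ∧ s ≤ up ν) : SharplyBounded S F lo up := by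
  obtain ⟨L, hL⟩ := (hF.image hlo).exists_isLeast (hne.image lo)
  obtain ⟨U, hU⟩ := (hF.image hup).exists_isGreatest (hne.image up)
  refine ⟨L, U, hL, hU, IsLeast.isGLB ⟨?_, ?_⟩, IsGreatest.isLUB ⟨?_, ?_⟩⟩
  · obtain ⟨ν, hν, rfl⟩ := hL.1
    exact hloS ν hν
  · intro s hs
    obtain ⟨ν, hν, h1, -⟩ := h s hs
    exact (hL.2 (mem_image_of_mem lo hν)).trans h1
  · obtain ⟨ν, hν, rfl⟩ := hU.1
    exact hupS ν hν
  · intro s hs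
    obtain ⟨ν, hν, -, h2⟩ := h s hs
    exact h2.trans (hU.2 (mem_image_of_mem up hν))

theorem sum_patches_subset_le {P₀ : Measure (Fin K → ℝ)} [IsProbabilityMeasure P₀]
    (x : Set (Fin K → ℝ)) [DecidablePred fun i : PatchOn p 0 => i.1 ⊆ x] :
    ∑ i : PatchOn p 0 with i.1 ⊆ x, P₀.real i.1 ≤ P₀.real x := by
  rw [← measureReal_biUnion_finset (fun _ _ _ _ => disjoint_patchOn)
    fun i _ => measurableSet_patchOn i]
  exact measureReal_mono (iUnion₂_subset fun i hi => (Finset.mem_filter.1 hi).2)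

theorem le_sum_patches_inter {P₀ : Measure (Fin K → ℝ)} [IsProbabilityMeasure P₀]
    (hP₀ : ∀ᵐ y ∂P₀, y ∈ budget (p 0)) (x : Set (Fin K → ℝ))
    [DecidablePred fun i : PatchOn p 0 => (i.1 ∩ x).Nonempty] :
    P₀.real x ≤ ∑ i : PatchOn p 0 with (i.1 ∩ x).Nonempty, P₀.real i.1 := by
  rw [← measureReal_biUnion_finset (fun _ _ _ _ => disjoint_patchOn)
    fun i _ => measurableSet_patchOn i]
  refine ENNReal.toReal_mono (measure_ne_top _ _) (measure_mono_ae ?_)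
  filter_upwards [hP₀] with y hy hyx
  obtain ⟨i, hi⟩ := exists_mem_patchOn hy
  exact mem_iUnion₂.2 ⟨i, Finset.mem_filter.2 ⟨Finset.mem_univ i, y, hi, hyx⟩, hi⟩

theorem sharplyBounded_event (hp : ∀ j, 0 ≤ p j) (hp0 : p 0 ≠ 0)
    (hP : Rationalizable (fun j => p j.succ) P) {x : Set (Fin K → ℝ)} (hx : MeasurableSet x) :
    SharplyBounded ((fun P₀ => P₀.real x) '' consistent p P) (feasible p P) (eventLower p x)
      (eventUpper p x) := by
  classical
  have hcont : ∀ i, Continuous fun ν => (A₀ p *ᵥ ν) i := fun i =>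
    (continuous_apply i).comp (Continuous.matrix_mulVec continuous_const continuous_id)
  refine sharplyBounded_of_attained isCompact_feasible (feasible_nonempty hp hp0 hP)
    (continuous_finsetSum _ fun i _ => hcont i) (continuous_finsetSum _ fun i _ => hcont i)
    (fun ν hν => ?_) (fun ν hν => ?_) ?_
  -- Selecting a point outside `x` whenever the patch has one attains the lower objective.
  · have : ∀ i : PatchOn p 0, ∃ y ∈ i.1, y ∈ x ↔ i.1 ⊆ x := fun i => by
      by_cases h : i.1 ⊆ x
      · obtain ⟨y, hy⟩ := nonempty_of_patchOn i
        exact ⟨y, hy, by simp [h, h hy]⟩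
      · obtain ⟨y, hy, hyx⟩ := not_subset.1 h
        exact ⟨y, hy, by simp [h, hyx]⟩
    choose q hq hqx using this
    refine ⟨_, sum_dirac_mem_consistent hp hP hν hq, ?_⟩
    simp only [real_sum_dirac hν.1.1 q hx, eventLower, hqx]
  -- Selecting a point inside `x` whenever the patch has one attains the upper objective.
  · have : ∀ i : PatchOn p 0, ∃ y ∈ i.1, y ∈ x ↔ (i.1 ∩ x).Nonempty := fun i => by
      by_cases h : (i.1 ∩ x).Nonempty
      · obtain ⟨y, hy, hyx⟩ := h
        exact ⟨y, hy, ⟨fun _ => ⟨y, hy, hyx⟩, fun _ => hyx⟩⟩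
      · obtain ⟨y, hy⟩ := nonempty_of_patchOn i
        exact ⟨y, hy, ⟨fun hyx => ⟨y, hy, hyx⟩, fun h' => absurd h' h⟩⟩
    choose q hq hqx using this
    refine ⟨_, sum_dirac_mem_consistent hp hP hν hq, ?_⟩
    simp only [real_sum_dirac hν.1.1 q hx, eventUpper, hqx]
  · rintro _ ⟨P₀, hP₀, rfl⟩
    obtain ⟨ν, hν, hνP⟩ := exists_feasible_of_mem_consistent hP₀
    have h0 : IsProbabilityMeasure P₀ := Rationalizable.isProbabilityMeasure hP₀ 0
    refine ⟨ν, hν, ?_, ?_⟩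
    · simp only [eventLower, hνP]
      exact sum_patches_subset_le (P₀ := P₀) x
    · simp only [eventUpper, hνP]
      exact le_sum_patches_inter (P₀ := P₀) (Rationalizable.ae_mem_budget hP₀ 0) x

/-- The supremum of `z ⬝ᵥ y` over a patch is at most `t` exactly when the patch lies in the
half-space, whether or not that supremum is attained. -/
theorem pLower_dotProduct (z : Fin K → ℝ) (t : ℝ) (ν : RationalType p → ℝ) :
    pLower p z t ⬝ᵥ (A₀ p *ᵥ ν) = eventLower p {y | z ⬝ᵥ y ≤ t} ν := by
  classical
  rw [eventLower, Finset.sum_filter]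
  refine Finset.sum_congr rfl fun i _ => ?_
  have : mUpper z i.1 ≤ (t : EReal) ↔ i.1 ⊆ {y | z ⬝ᵥ y ≤ t} := by
    simp only [mUpper, iSup_le_iff, EReal.coe_le_coe_iff]
    rfl
  rw [pLower, ite_mul, one_mul, zero_mul]
  exact if_congr this rfl rfl

theorem pUpper_dotProduct (z : Fin K → ℝ) (t : ℝ) (ν : RationalType p → ℝ) :
    pUpper p z t ⬝ᵥ (A₀ p *ᵥ ν) = eventUpper p {y | z ⬝ᵥ y ≤ t} ν := by
  classical
  rw [eventUpper, Finset.sum_filter]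
  refine Finset.sum_congr rfl fun i _ => ?_
  rw [pUpper, ite_mul, one_mul, zero_mul]

theorem pUpper_eq_one_of_mLower_lt {z : Fin K → ℝ} {t : ℝ} {i : PatchOn p 0}
    (h : mLower z i.1 < (t : EReal)) : pUpper p z t i = 1 := by
  simp only [mLower, iInf_lt_iff, EReal.coe_lt_coe_iff] at h
  obtain ⟨y, hy, hyt⟩ := h
  exact if_pos ⟨y, hy, hyt.le⟩

theorem pUpper_eq_zero_of_lt_mLower {z : Fin K → ℝ} {t : ℝ} {i : PatchOn p 0}
    (h : (t : EReal) < mLower z i.1) : pUpper p z t i = 0 := by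
  refine if_neg ?_
  rintro ⟨y, hy, hyt⟩
  have : mLower z i.1 ≤ ((z ⬝ᵥ y : ℝ) : EReal) := iInf₂_le y hy
  exact (h.trans_le this).not_ge (EReal.coe_le_coe_iff.2 hyt)

end RandomUtility

theorem corollary2 {K J : ℕ} (p : Fin (J + 1) → Fin K → ℝ) (hp : ∀ j, 0 ≤ p j) (hp0 : p 0 ≠ 0)
    (P : Fin J → MeasureTheory.Measure (Fin K → ℝ))
    (hP : RandomUtility.Rationalizable (fun j => p j.succ) P) :
    (∀ x : Set (Fin K → ℝ), x ⊆ RandomUtility.budget (p 0) → MeasurableSet x →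
      RandomUtility.SharplyBounded
        ((fun P₀ => P₀.real x) '' RandomUtility.consistent p P)
        (RandomUtility.feasible p P)
        (RandomUtility.eventLower p x) (RandomUtility.eventUpper p x)) ∧
    (∀ (z : Fin K → ℝ) (t : ℝ),
      (∀ i : RandomUtility.PatchOn p 0,
        (RandomUtility.mLower z i.1 < (t : EReal) → RandomUtility.pUpper p z t i = 1) ∧
        ((t : EReal) < RandomUtility.mLower z i.1 → RandomUtility.pUpper p z t i = 0)) ∧
      RandomUtility.SharplyBounded
        ((fun P₀ => P₀.real {y | z ⬝ᵥ y ≤ t}) '' RandomUtility.consistent p P)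
        (RandomUtility.feasible p P)
        (fun ν => RandomUtility.pLower p z t ⬝ᵥ (RandomUtility.A₀ p *ᵥ ν))
        (fun ν => RandomUtility.pUpper p z t ⬝ᵥ (RandomUtility.A₀ p *ᵥ ν))) := by
  refine ⟨fun x _ hx => RandomUtility.sharplyBounded_event hp hp0 hP hx, fun z t => ⟨fun i =>
    ⟨RandomUtility.pUpper_eq_one_of_mLower_lt, RandomUtility.pUpper_eq_zero_of_lt_mLower⟩, ?_⟩⟩
  simp only [RandomUtility.pLower_dotProduct, RandomUtility.pUpper_dotProduct]
  exact RandomUtility.sharplyBounded_event hp hp0 hP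
    (measurableSet_le (RandomUtility.measurable_dotProduct z) measurable_const)
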